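/- Let $\kappa,\lambda$ be cardinals with $\omega_1\le\kappa<\lambda$ and $2^\kappa=2^\lambda$. For a topological space $X$, let $\Delta(X)$ denote its dispersion character, i.e. the smallest cardinality of a nonempty open subset of $X$. For a cardinal $\theta$, call $X$ $\theta$-resolvable if it contains $\theta$ many pairwise disjoint dense subsets, and $\theta$-irresolvable if $\theta\le\Delta(X)$ and $X$ is not $\theta$-resolvable. Then there is a regular $T_1$ space $X$ such that $|X|=\Delta(X)=\lambda$, every continuous function $X\to\mathbb{R}$ is constant (so $X$ is connected, and pseudocompact in the sense that every continuous real-valued function on $X$ is bounded), and $X$ is $\kappa^+$-irresolvable. -/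

import Mathlib

open Cardinal

universe u

/-- The dispersion character `Δ(X)`: the smallest cardinality of a nonempty open subset of `X`. -/
noncomputable def dispersionCharacter (X : Type u) [TopologicalSpace X] : Cardinal.{u} :=
  sInf {c : Cardinal.{u} | ∃ U : Set X, IsOpen U ∧ U.Nonempty ∧ #U = c}

/-- `X` is `κ`-resolvable: it contains `κ` many pairwise disjoint dense subsets. -/
def IsResolvable (κ : Cardinal.{u}) (X : Type u) [TopologicalSpace X] : Prop :=
  ∃ 𝒟 : Set (Set X), #𝒟 = κ ∧ (∀ D ∈ 𝒟, Dense D) ∧ 𝒟.PairwiseDisjoint id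

/-- `X` is `κ`-irresolvable: `κ ≤ Δ(X)` and `X` is not `κ`-resolvable. -/
def IsIrresolvable (κ : Cardinal.{u}) (X : Type u) [TopologicalSpace X] : Prop :=
  κ ≤ dispersionCharacter X ∧ ¬ IsResolvable κ X

/-- `X` is pseudocompact: every continuous real-valued function on `X` is bounded. -/
def IsPseudocompact (X : Type u) [TopologicalSpace X] : Prop :=
  ∀ f : X → ℝ, Continuous f → Bornology.IsBounded (Set.range f)

/-! Let `G` be a nondegenerate regular T₁ space with at most ℵ₁ points and only constant continuous
real functions. The space `X` is the union of two dense subsets of the power of `G` with exponent `2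
^ λ`. The set `F` of step functions has at most κ points; it is dense because `2 ^ λ = 2 ^ κ` lets
subsets of a set of size κ index the coordinates. It is a union of continuous images of finite
powers of `G` through a common point, so continuous real functions on `X` are constant
(`StepFn.exists_forall_eq`). The set `range y` has λ points in every nonempty open set and no two
disjoint dense subsets (`exists_injective_forall_dense_image`). Among κ⁺ disjoint dense subsets of
`X`, two would miss `F` and be disjoint dense subsets of `range y`. To obtain `G`, a space with two
inseparable points (`Ladder`) is copied so as to tie every point to a single hub (`Thread`). -/

open Set Filter Topology

/-! ### A regular space with two points that no continuous real function separates. -/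

/-- The points of a space with two ends which no continuous real function separates: levels
indexed by `ℤ`, and a rung between any two points of consecutive levels. -/
inductive Ladder (W : Type u) : Type u
  | bot : Ladder W
  | top : Ladder W
  | lvl (n : ℤ) (x : W) : Ladder W
  | rung (n : ℤ) (x y : W) : Ladder W

namespace Ladder

variable {W : Type u}

/-- Rungs are isolated, a level point is the limit of the rungs ending in it, and the two ends are
the limits of the levels. -/
instance : TopologicalSpace (Ladder W) where
  IsOpen U :=
    (∀ n x, lvl n x ∈ U → {y | rung n x y ∉ U}.Finite ∧ {y | rung (n - 1) y x ∉ U}.Finite) ∧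
    (top ∈ U → ∃ N, ∀ n ≥ N, ∀ x, lvl n x ∈ U ∧ ∀ y, rung n x y ∈ U) ∧
    (bot ∈ U → ∃ N, ∀ n ≤ N, ∀ x, lvl n x ∈ U ∧ ∀ y, rung n x y ∈ U)
  isOpen_univ := by simp
  isOpen_inter := by
    rintro s t ⟨hs, hs', hs''⟩ ⟨ht, ht', ht''⟩
    refine ⟨fun n x h => ⟨?_, ?_⟩, fun h => ?_, fun h => ?_⟩
    · exact ((hs n x h.1).1.union (ht n x h.2).1).subset fun y hy => by
        simp only [mem_ofPred_eq, mem_inter_iff, mem_union] at hy ⊢; tauto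
    · exact ((hs n x h.1).2.union (ht n x h.2).2).subset fun y hy => by
        simp only [mem_ofPred_eq, mem_inter_iff, mem_union] at hy ⊢; tauto
    · obtain ⟨N, hN⟩ := hs' h.1
      obtain ⟨M, hM⟩ := ht' h.2
      refine ⟨max N M, fun n hn x => ?_⟩
      have h1 := hN n (le_trans (le_max_left _ _) hn) x
      have h2 := hM n (le_trans (le_max_right _ _) hn) x
      exact ⟨⟨h1.1, h2.1⟩, fun y => ⟨h1.2 y, h2.2 y⟩⟩
    · obtain ⟨N, hN⟩ := hs'' h.1
      obtain ⟨M, hM⟩ := ht'' h.2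
      refine ⟨min N M, fun n hn x => ?_⟩
      have h1 := hN n (le_trans hn (min_le_left _ _)) x
      have h2 := hM n (le_trans hn (min_le_right _ _)) x
      exact ⟨⟨h1.1, h2.1⟩, fun y => ⟨h1.2 y, h2.2 y⟩⟩
  isOpen_sUnion := by
    intro S hS
    refine ⟨?_, ?_, ?_⟩
    · rintro n x ⟨t, ht, hx⟩
      exact ⟨((hS t ht).1 n x hx).1.subset fun y hy h => hy ⟨t, ht, h⟩,
        ((hS t ht).1 n x hx).2.subset fun y hy h => hy ⟨t, ht, h⟩⟩
    · rintro ⟨t, ht, hx⟩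
      obtain ⟨N, hN⟩ := (hS t ht).2.1 hx
      exact ⟨N, fun n hn x => ⟨⟨t, ht, (hN n hn x).1⟩, fun y => ⟨t, ht, (hN n hn x).2 y⟩⟩⟩
    · rintro ⟨t, ht, hx⟩
      obtain ⟨N, hN⟩ := (hS t ht).2.2 hx
      exact ⟨N, fun n hn x => ⟨⟨t, ht, (hN n hn x).1⟩, fun y => ⟨t, ht, (hN n hn x).2 y⟩⟩⟩

theorem isOpen_iff {U : Set (Ladder W)} : IsOpen U ↔
    (∀ n x, lvl n x ∈ U → {y | rung n x y ∉ U}.Finite ∧ {y | rung (n - 1) y x ∉ U}.Finite) ∧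
    (top ∈ U → ∃ N, ∀ n ≥ N, ∀ x, lvl n x ∈ U ∧ ∀ y, rung n x y ∈ U) ∧
    (bot ∈ U → ∃ N, ∀ n ≤ N, ∀ x, lvl n x ∈ U ∧ ∀ y, rung n x y ∈ U) := Iff.rfl

theorem isClosed_singleton_rung (m : ℤ) (a b : W) : IsClosed {rung m a b} := by
  rw [← isOpen_compl_iff, isOpen_iff]
  refine ⟨fun n x _ => ⟨?_, ?_⟩, fun _ => ⟨m + 1, fun n hn x => ?_⟩,
    fun _ => ⟨m - 1, fun n hn x => ?_⟩⟩
  · exact (finite_singleton b).subset fun y hy => by simp at hy; simp [hy]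
  · exact (finite_singleton a).subset fun y hy => by simp at hy; simp [hy]
  · simp; omega
  · simp; omega

instance : T1Space (Ladder W) := by
  refine ⟨fun p => ?_⟩
  rcases p with _ | _ | ⟨m, a⟩ | ⟨m, a, b⟩
  · rw [← isOpen_compl_iff, isOpen_iff]; simp
  · rw [← isOpen_compl_iff, isOpen_iff]; simp
  · rw [← isOpen_compl_iff, isOpen_iff]
    refine ⟨by simp, fun _ => ⟨m + 1, fun n hn x => ?_⟩, fun _ => ⟨m - 1, fun n hn x => ?_⟩⟩
    · simp; omega
    · simp; omega
  · exact isClosed_singleton_rung m a b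

/-- The level point `(m, a)` together with the rungs ending in it. -/
def star (m : ℤ) (a : W) : Set (Ladder W) :=
  {p | p = lvl m a ∨ (∃ y, p = rung m a y) ∨ ∃ y, p = rung (m - 1) y a}

/-- Two distinct stars share at most one rung, so removing one star costs any other level point
finitely many rungs. Hence level points have clopen neighbourhood bases. -/
theorem isClosed_star_inter {U : Set (Ladder W)} (m : ℤ) (a : W) (ha : lvl m a ∈ U) :
    IsClosed (star m a ∩ U) := by
  rw [← isOpen_compl_iff, isOpen_iff]
  refine ⟨fun n x h => ⟨?_, ?_⟩, fun _ => ⟨m + 1, fun n hn x => ?_⟩,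
    fun _ => ⟨m - 2, fun n hn x => ?_⟩⟩
  · refine (finite_singleton a).subset fun y hy => ?_
    simp only [star, mem_compl_iff, mem_inter_iff, mem_ofPred_eq, lvl.injEq, rung.injEq,
      reduceCtorEq, not_not, false_or, exists_false, or_false] at h hy ⊢
    grind
  · refine (finite_singleton a).subset fun y hy => ?_
    simp only [star, mem_compl_iff, mem_inter_iff, mem_ofPred_eq, lvl.injEq, rung.injEq,
      reduceCtorEq, not_not, false_or, exists_false, or_false] at h hy ⊢
    grind
  · simp [star]; grind
  · simp [star]; grind

theorem isOpen_star_inter {U : Set (Ladder W)} (hU : IsOpen U) (m : ℤ) (a : W) :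
    IsOpen (star m a ∩ U) := by
  rw [isOpen_iff] at hU ⊢
  refine ⟨fun n x h => ?_, by simp [star], by simp [star]⟩
  obtain ⟨h1, h2⟩ := hU.1 n x h.2
  have hx : n = m ∧ x = a := by simpa [star] using h.1
  obtain ⟨rfl, rfl⟩ := hx
  exact ⟨h1.subset fun y hy h => hy ⟨by simp [star], h⟩,
    h2.subset fun y hy h => hy ⟨by simp [star], h⟩⟩

instance : RegularSpace (Ladder W) := by
  refine RegularSpace.of_exists_mem_nhds_isClosed_subset fun p s hs => ?_
  obtain ⟨U, hUs, hU, hp⟩ := mem_nhds_iff.1 hs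
  suffices h : ∃ V C, IsOpen V ∧ p ∈ V ∧ V ⊆ C ∧ IsClosed C ∧ C ⊆ U by
    obtain ⟨V, C, hV, hpV, hVC, hC, hCU⟩ := h
    exact ⟨C, mem_of_superset (hV.mem_nhds hpV) hVC, hC, hCU.trans hUs⟩
  rcases p with _ | _ | ⟨m, a⟩ | ⟨m, a, b⟩
  · obtain ⟨N, hN⟩ := (isOpen_iff.1 hU).2.2 hp
    -- The rungs of index `N - 1` accumulate at level `N`, so the closed set includes that level
    -- while the open one stops below it.
    refine ⟨{p | p = bot ∨ (∃ n x, n < N ∧ p = lvl n x) ∨ ∃ n x y, n < N ∧ p = rung n x y},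
      {p | p = bot ∨ (∃ n x, n ≤ N ∧ p = lvl n x) ∨ ∃ n x y, n < N ∧ p = rung n x y},
      ?_, by simp, ?_, ?_, ?_⟩
    · rw [isOpen_iff]
      refine ⟨fun n x h => ?_, by simp, fun _ => ⟨N - 1, fun n hn x => ?_⟩⟩
      · have hn : n < N := by simpa using h
        simp [show ¬ N ≤ n by omega, show ¬ N < n by omega]
      · simp [show n < N by omega]
    · rintro p (h | ⟨n, x, hn, h⟩ | h)
      · exact .inl h
      · exact .inr (.inl ⟨n, x, by omega, h⟩)
      · exact .inr (.inr h)
    · rw [← isOpen_compl_iff, isOpen_iff]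
      refine ⟨fun n x h => ?_, fun _ => ⟨N + 1, fun n hn x => ?_⟩, by simp⟩
      · have hn : N < n := by simpa using h
        simp [show ¬ n < N by omega, show ¬ n - 1 < N by omega]
      · simp [show N < n by omega, show N ≤ n by omega]
    · rintro p (rfl | ⟨n, x, hn, rfl⟩ | ⟨n, x, y, hn, rfl⟩)
      · exact hp
      · exact (hN n hn x).1
      · exact (hN n (by omega) x).2 y
  · obtain ⟨N, hN⟩ := (isOpen_iff.1 hU).2.1 hp
    refine ⟨{p | p = top ∨ (∃ n x, N < n ∧ p = lvl n x) ∨ ∃ n x y, N ≤ n ∧ p = rung n x y},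
      {p | p = top ∨ (∃ n x, N ≤ n ∧ p = lvl n x) ∨ ∃ n x y, N ≤ n ∧ p = rung n x y},
      ?_, by simp, ?_, ?_, ?_⟩
    · rw [isOpen_iff]
      refine ⟨fun n x h => ?_, fun _ => ⟨N + 1, fun n hn x => ?_⟩, by simp⟩
      · have hn : N < n := by simpa using h
        simp [show ¬ n < N by omega, show ¬ n ≤ N by omega]
      · simp [show N < n by omega, show N ≤ n by omega]
    · rintro p (h | ⟨n, x, hn, h⟩ | h)
      · exact .inl h
      · exact .inr (.inl ⟨n, x, by omega, h⟩)
      · exact .inr (.inr h)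
    · rw [← isOpen_compl_iff, isOpen_iff]
      refine ⟨fun n x h => ?_, by simp, fun _ => ⟨N - 1, fun n hn x => ?_⟩⟩
      · have hn : n < N := by simpa using h
        simp [show ¬ N ≤ n by omega, show ¬ N ≤ n - 1 by omega]
      · simp [show n < N by omega]
    · rintro p (rfl | ⟨n, x, hn, rfl⟩ | ⟨n, x, y, hn, rfl⟩)
      · exact hp
      · exact (hN n (by omega) x).1
      · exact (hN n hn x).2 y
  · exact ⟨_, _, isOpen_star_inter hU m a, ⟨by simp [star], hp⟩, Subset.rfl,
      isClosed_star_inter m a hp, inter_subset_right⟩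
  · exact ⟨{rung m a b}, {rung m a b}, by rw [isOpen_iff]; simp, rfl, Subset.rfl,
      isClosed_singleton_rung m a b, singleton_subset_iff.2 hp⟩

theorem tendsto_rung_right (n : ℤ) (x : W) :
    Tendsto (rung n x) cofinite (𝓝 (lvl n x)) := by
  intro s hs
  obtain ⟨U, hUs, hU, hp⟩ := mem_nhds_iff.1 hs
  exact ((isOpen_iff.1 hU).1 n x hp).1.subset fun y hy h => hy (hUs h)

theorem tendsto_rung_left (n : ℤ) (y : W) :
    Tendsto (fun x => rung n x y) cofinite (𝓝 (lvl (n + 1) y)) := by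
  intro s hs
  obtain ⟨U, hUs, hU, hp⟩ := mem_nhds_iff.1 hs
  have := ((isOpen_iff.1 hU).1 (n + 1) y hp).2
  rw [add_sub_cancel_right] at this
  exact this.subset fun y hy h => hy (hUs h)

/-- Only finitely many points are mapped outside each ball of radius `1 / (k + 1)`; take the union
over `k`. -/
theorem eventually_eq_of_tendsto_cofinite {f : W → ℝ} {r : ℝ} (hf : Tendsto f cofinite (𝓝 r)) :
    {x | f x ≠ r}.Countable := by
  have h : {x | f x ≠ r} = ⋃ k : ℕ, {x | ¬ |f x - r| < 1 / (k + 1)} := by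
    ext x
    simp only [mem_ofPred_eq, mem_iUnion, not_lt]
    constructor
    · intro hx
      obtain ⟨k, hk⟩ := exists_nat_one_div_lt (abs_pos.2 (sub_ne_zero.2 hx))
      exact ⟨k, hk.le⟩
    · rintro ⟨k, hk⟩ rfl
      have : (0 : ℝ) < 1 / (k + 1) := by positivity
      simp at hk
      linarith
  rw [h]
  refine countable_iUnion fun k => Finite.countable ?_
  have := hf (Metric.ball_mem_nhds r (ε := 1 / ((k : ℝ) + 1)) (by positivity))
  refine Finite.subset (mem_map.1 this) fun x hx => ?_
  simpa [Metric.mem_ball, Real.dist_eq] using hx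

/-- If `f` takes values in the closed set `Z` at infinitely many points of a level, then it does so
at all but countably many points of the next one. -/
theorem countable_compl_succ {f : Ladder W → ℝ} (hf : Continuous f) {Z : Set ℝ} (hZ : IsClosed Z)
    (n : ℤ) (h : {x | f (lvl n x) ∈ Z}.Infinite) : {y | f (lvl (n + 1) y) ∉ Z}.Countable := by
  -- Countability of `C` leaves all but countably many `y` with `f (rung n x y) = f (lvl n x)` for
  -- every `x ∈ C` at once; infinitude of `C` makes these rungs accumulate at `lvl (n + 1) y`.
  obtain ⟨C, hCs, hCinf, hCc⟩ : ∃ C ⊆ {x | f (lvl n x) ∈ Z}, C.Infinite ∧ C.Countable := by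
    refine ⟨range fun k => (h.natEmbedding _ k : W), ?_, ?_, countable_range _⟩
    · rintro _ ⟨k, rfl⟩
      exact (h.natEmbedding _ k).2
    · exact infinite_range_of_injective
        (Subtype.val_injective.comp (h.natEmbedding _).injective)
  have hc : (⋃ x ∈ C, {y | f (rung n x y) ≠ f (lvl n x)}).Countable :=
    hCc.biUnion fun x _ => eventually_eq_of_tendsto_cofinite
      ((hf.tendsto _).comp (tendsto_rung_right n x))
  refine hc.mono fun y hy => ?_
  by_contra hne
  simp only [mem_iUnion, mem_ofPred_eq, not_exists, not_not] at hne
  have ht := (hf.tendsto _).comp (tendsto_rung_left n y)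
  have : (cofinite ⊓ 𝓟 C).NeBot := cofinite_inf_principal_neBot_iff.2 hCinf
  refine hy (hZ.mem_of_tendsto (ht.mono_left (inf_le_left : cofinite ⊓ 𝓟 C ≤ _)) ?_)
  filter_upwards [mem_inf_of_right (mem_principal_self C)] with x hx
  simp only [Function.comp_apply, hne x hx]
  exact hCs hx

/-- Closeness to `f bot` climbs from level to level with countably many exceptions on each. As `W`
is uncountable, every level keeps a good point, and such points converge to `top`. -/
theorem apply_top_eq_apply_bot [Uncountable W] {f : Ladder W → ℝ} (hf : Continuous f) :
    f top = f bot := by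
  refine eq_of_forall_dist_le fun ε hε => ?_
  set Z := Metric.closedBall (f bot) ε with hZ
  have hZc : IsClosed Z := Metric.isClosed_closedBall
  have hnhds : f ⁻¹' Metric.ball (f bot) ε ∈ 𝓝 bot :=
    hf.continuousAt (Metric.ball_mem_nhds _ hε)
  obtain ⟨U, hUs, hU, hp⟩ := mem_nhds_iff.1 hnhds
  obtain ⟨N, hN⟩ := (isOpen_iff.1 hU).2.2 hp
  have hcount : ∀ k : ℕ, {y | f (lvl (N + k) y) ∉ Z}.Countable := by
    intro k
    induction k with
    | zero =>
      convert countable_empty (α := W)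
      refine eq_empty_of_forall_notMem fun y hy => hy ?_
      simp only [CharP.cast_eq_zero, add_zero]
      exact Metric.ball_subset_closedBall (hUs (hN N le_rfl y).1)
    | succ k ih =>
      have := countable_compl_succ hf hZc (N + k) (fun hfin => by
        have := ih.union hfin.countable
        refine not_countable_univ (this.mono fun y _ => ?_)
        exact (em (f (lvl (N + k) y) ∈ Z)).symm)
      push_cast
      rwa [← add_assoc]
  have hex (k : ℕ) : ∃ y, f (lvl (N + k) y) ∈ Z := by
    by_contra! hne
    exact not_countable_univ ((hcount k).mono fun y _ => hne y)
  choose y hy using hex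
  have ht : Tendsto (fun k : ℕ => lvl (N + k) (y k)) atTop (𝓝 (top : Ladder W)) := by
    intro s hs
    obtain ⟨V, hVs, hV, hp⟩ := mem_nhds_iff.1 hs
    obtain ⟨M, hM⟩ := (isOpen_iff.1 hV).2.1 hp
    refine mem_map.2 (mem_atTop_sets.2 ⟨(M - N).toNat, fun k hk => hVs (hM _ ?_ _).1⟩)
    omega
  have := hZc.mem_of_tendsto ((hf.tendsto _).comp ht)
    (Eventually.of_forall hy)
  exact this

theorem mk_le {c : Cardinal.{u}} (hc : ℵ₀ ≤ c) (hW : #W ≤ c) : #(Ladder W) ≤ c := by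
  let g : Ladder W → Bool ⊕ (ℤ × W) ⊕ (ℤ × W × W)
    | bot => .inl false
    | top => .inl true
    | lvl n x => .inr (.inl (n, x))
    | rung n x y => .inr (.inr (n, x, y))
  have hg : Function.Injective g := by
    intro p q h
    cases p <;> cases q <;> simp_all [g]
  refine (mk_le_of_injective hg).trans ?_
  have h2 : #W * #W ≤ c := (mul_le_mul' hW hW).trans (mul_eq_self hc).le
  have h3 : ℵ₀ * #W ≤ c := (mul_le_mul' hc hW).trans (mul_eq_self hc).le
  have h4 : ℵ₀ * (#W * #W) ≤ c := (mul_le_mul' hc h2).trans (mul_eq_self hc).le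
  have h5 : (2 : Cardinal.{u}) ≤ c := (natCast_lt_aleph0 (n := 2)).le.trans hc
  simp only [mk_sum, mk_prod, mk_bool, mk_eq_aleph0, lift_id, lift_uzero, lift_aleph0, lift_ofNat]
  exact add_le_of_le hc (by simpa using h5) (add_le_of_le hc (by simpa using h3) (by simpa using h4))

end Ladder

/-! ### Copies of `P` tied to a hub: a regular space with only constant real functions. -/

/-- Words in the points of `P` other than `a` and `b`, together with one more point, the hub. Each
word `w` is joined to the hub by a copy of `P`, see `Thread.strand`. -/
inductive Thread (P : Type u) (a b : P) : Type u
  | hub : Thread P a b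
  | node (w : List {p : P // p ≠ a ∧ p ≠ b}) : Thread P a b

namespace Thread

variable {P : Type u} {a b : P}

open Classical in
/-- The copy of `P` which joins the word `w`, in the role of `a`, to the hub, in the role of `b`. -/
noncomputable def strand (w : List {p : P // p ≠ a ∧ p ≠ b}) (p : P) : Thread P a b :=
  if ha : p = a then node w else if hb : p = b then hub else node (⟨p, ha, hb⟩ :: w)

@[simp] theorem strand_left (w : List {p : P // p ≠ a ∧ p ≠ b}) : strand w a = node w := by
  simp [strand]

theorem strand_right (hab : a ≠ b) (w : List {p : P // p ≠ a ∧ p ≠ b}) : strand w b = hub := by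
  simp [strand, hab.symm]

@[simp] theorem strand_coe (w : List {p : P // p ≠ a ∧ p ≠ b}) (y : {p : P // p ≠ a ∧ p ≠ b}) :
    strand w (y : P) = node (y :: w) := by
  simp [strand, y.2.1, y.2.2]

theorem strand_injective (w : List {p : P // p ≠ a ∧ p ≠ b}) :
    Function.Injective (strand w) := by
  intro p q h
  unfold strand at h
  split_ifs at h <;> simp_all

theorem set_ext_of_ends {a b : P} (s t : Set P) (h1 : a ∈ s ↔ a ∈ t) (h2 : b ∈ s ↔ b ∈ t)
    (h3 : ∀ y : {p : P // p ≠ a ∧ p ≠ b}, (y : P) ∈ s ↔ (y : P) ∈ t) : s = t := by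
  ext p
  by_cases ha : p = a
  · rwa [ha]
  by_cases hb : p = b
  · rwa [hb]
  exact h3 ⟨p, ha, hb⟩

theorem mk_le {c : Cardinal.{u}} (hc : ℵ₀ ≤ c) (hP : #P ≤ c) : #(Thread P a b) ≤ c := by
  have h : Function.Injective fun t : Thread P a b =>
      (match t with | hub => none | node w => some w : Option (List {p : P // p ≠ a ∧ p ≠ b})) := by
    rintro (_ | w) (_ | v) <;> simp
  refine (mk_le_of_injective h).trans ?_
  rw [mk_option]
  refine add_le_of_le hc ((mk_list_le_max _).trans (max_le hc ((mk_subtype_le _).trans hP))) ?_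
  exact one_le_aleph0.trans hc

variable [TopologicalSpace P]

/-- The finest topology which makes every `strand w` continuous. -/
noncomputable instance : TopologicalSpace (Thread P a b) := ⨆ w, TopologicalSpace.coinduced (strand w) ‹_›

theorem isOpen_iff {U : Set (Thread P a b)} : IsOpen U ↔ ∀ w, IsOpen (strand w ⁻¹' U) := by
  rw [isOpen_iSup_iff]
  simp only [isOpen_coinduced]

theorem isClosed_iff {U : Set (Thread P a b)} : IsClosed U ↔ ∀ w, IsClosed (strand w ⁻¹' U) := by
  rw [← isOpen_compl_iff, isOpen_iff]
  simp only [preimage_compl, isOpen_compl_iff]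

theorem continuous_strand (w : List {p : P // p ≠ a ∧ p ≠ b}) :
    Continuous (strand w : P → Thread P a b) :=
  continuous_iff_coinduced_le.2 (le_iSup (fun w => TopologicalSpace.coinduced (strand w) _) w)

/-- The words that are reached from the empty word (if `r` holds), from the hub (if `o` holds) and
from the seeds `V₀`, extending a word `w` by the letters in `A w` and the hub by those in `B w`. -/
def Grows (r o : Prop) (V₀ A B : List {p : P // p ≠ a ∧ p ≠ b} → Set P) :
    List {p : P // p ≠ a ∧ p ≠ b} → Prop
  | [] => r
  | y :: w => y.1 ∈ V₀ w ∨ (Grows r o V₀ A B w ∧ y.1 ∈ A w) ∨ (o ∧ y.1 ∈ B w)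

/-- An open set containing `node w` must contain a neighbourhood of `a` in the strand of `w`, hence
further words, and so on; `Grows` closes the seeds under this. Neighbourhoods of one end are chosen
with closures avoiding the other end, so growth from words never forces the hub in. -/
theorem exists_isOpen_isClosed [RegularSpace P] [T1Space P] (hab : a ≠ b) {U : Set (Thread P a b)}
    (hU : IsOpen U) (r o : Prop) (hr : r → node [] ∈ U) (ho : o → hub ∈ U)
    {V₀ C₀ : List {p : P // p ≠ a ∧ p ≠ b} → Set P} (hV₀ : ∀ w, IsOpen (V₀ w))
    (hC₀ : ∀ w, IsClosed (C₀ w)) (hVC₀ : ∀ w, V₀ w ⊆ C₀ w) (hC₀U : ∀ w, C₀ w ⊆ strand w ⁻¹' U)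
    (ha : ∀ w, a ∉ C₀ w) (hb : ∀ w, b ∉ C₀ w) :
    ∃ V C, IsOpen V ∧ IsClosed C ∧ V ⊆ C ∧ C ⊆ U ∧ (r → node [] ∈ V) ∧ (o → hub ∈ V) ∧
      ∀ w (y : {p : P // p ≠ a ∧ p ≠ b}), y.1 ∈ V₀ w → node (y :: w) ∈ V := by
  have key (p q : P) (hpq : p ≠ q) (w : List {p : P // p ≠ a ∧ p ≠ b}) :
      ∃ N K : Set P, IsOpen N ∧ IsClosed K ∧ N ⊆ K ∧ p ∈ N ∧ q ∉ K ∧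
        (strand w p ∈ U → K ⊆ strand w ⁻¹' U) := by
    have hopen : IsOpen ({q}ᶜ ∩ {x | strand w p ∈ U → x ∈ strand w ⁻¹' U}) := by
      refine isOpen_compl_singleton.inter ?_
      by_cases hp : strand w p ∈ U
      · simpa [hp] using! isOpen_iff.1 hU w
      · simp [hp]
    obtain ⟨K, hK, hKc, hKs⟩ := exists_mem_nhds_isClosed_subset
      (hopen.mem_nhds (show p ∈ _ from ⟨hpq, fun h => h⟩))
    exact ⟨interior K, K, isOpen_interior, hKc, interior_subset, mem_interior_iff_mem_nhds.2 hK,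
      fun hq => (hKs hq).1 rfl, fun hp x hx => (hKs hx).2 hp⟩
  choose A A' hA hA' hAA' haA hbA hAU using key a b hab
  choose B B' hB hB' hBB' hbB haB hBU using key b a hab.symm
  simp only [strand_left, strand_right hab] at hAU hBU
  set G := Grows r o V₀ A B with hG
  -- Only the last letter is relaxed to the closed sets. A word in `G'` but not in `G` starts no
  -- growth: it adds just the closed point `a` to its own strand.
  let G' : List {p : P // p ≠ a ∧ p ≠ b} → Prop
    | [] => r
    | y :: w => y.1 ∈ C₀ w ∨ (G w ∧ y.1 ∈ A' w) ∨ (o ∧ y.1 ∈ B' w)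
  have hGG' : ∀ w, G w → G' w := by
    rintro (_ | ⟨y, w⟩) h
    · exact h
    · exact h.imp (fun h => hVC₀ w h) (Or.imp (fun h => ⟨h.1, hAA' w h.2⟩) fun h => ⟨h.1, hBB' w h.2⟩)
  have hG'U : ∀ w, G' w → node w ∈ U := by
    intro w
    induction w with
    | nil => exact hr
    | cons y w ih =>
      rintro (h | ⟨h, hy⟩ | ⟨h, hy⟩)
      · simpa using hC₀U w h
      · simpa using hAU w (ih (hGG' w h)) hy
      · simpa using hBU w (ho h) hy
  refine ⟨{t | (t = hub ∧ o) ∨ ∃ w, t = node w ∧ G w}, {t | (t = hub ∧ o) ∨ ∃ w, t = node w ∧ G' w},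
    isOpen_iff.2 fun w => ?_, isClosed_iff.2 fun w => ?_, ?_, ?_, ?_, ?_, ?_⟩
  · have : strand w ⁻¹' {t | (t = hub ∧ o) ∨ ∃ w, t = node w ∧ G w} =
        V₀ w ∪ ({p | G w ∧ p ∈ A w} ∪ {p | o ∧ p ∈ B w}) := by
      refine set_ext_of_ends (a := a) (b := b) _ _ ?_ ?_ fun y => ?_
      · have h1 : a ∉ V₀ w := fun h => ha w (hVC₀ w h)
        have h2 : a ∉ B w := fun h => haB w (hBB' w h)
        simp [h1, h2, haA]
      · have h1 : b ∉ V₀ w := fun h => hb w (hVC₀ w h)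
        have h2 : b ∉ A w := fun h => hbA w (hAA' w h)
        simp [strand_right hab, h1, h2, hbB]
      · simp [hG, Grows]
    rw [this]
    refine (hV₀ w).union (IsOpen.union ?_ ?_)
    · by_cases h : G w <;> simp [h, hA]
    · by_cases h : o <;> simp [h, hB]
  · have : strand w ⁻¹' {t | (t = hub ∧ o) ∨ ∃ w, t = node w ∧ G' w} =
        C₀ w ∪ ({p | G w ∧ p ∈ A' w} ∪ {p | o ∧ p ∈ B' w}) ∪ {p | G' w ∧ p = a} := by
      refine set_ext_of_ends (a := a) (b := b) _ _ ?_ ?_ fun y => ?_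
      · have := hGG' w
        simp [ha, haB]
        tauto
      · simp [strand_right hab, hb, hbA, hBB' w (hbB w), hab.symm]
      · simp [G', y.2.1]
    rw [this]
    refine ((hC₀ w).union (IsClosed.union ?_ ?_)).union ?_
    · by_cases h : G w <;> simp [h, hA']
    · by_cases h : o <;> simp [h, hB']
    · by_cases h : G' w <;> simp [h]
  · rintro t (h | ⟨w, rfl, h⟩)
    · exact .inl h
    · exact .inr ⟨w, rfl, hGG' w h⟩
  · rintro t (⟨rfl, h⟩ | ⟨w, rfl, h⟩)
    · exact ho h
    · exact hG'U w h
  · exact fun h => .inr ⟨[], rfl, h⟩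
  · exact fun h => .inl ⟨rfl, h⟩
  · exact fun w y h => .inr ⟨y :: w, rfl, .inl h⟩

theorem regularSpace [RegularSpace P] [T1Space P] (hab : a ≠ b) : RegularSpace (Thread P a b) := by
  refine RegularSpace.of_exists_mem_nhds_isClosed_subset fun p s hs => ?_
  obtain ⟨U, hUs, hU, hp⟩ := mem_nhds_iff.1 hs
  suffices h : ∃ V C, IsOpen V ∧ IsClosed C ∧ V ⊆ C ∧ C ⊆ U ∧ p ∈ V by
    obtain ⟨V, C, hV, hC, hVC, hCU, hpV⟩ := h
    exact ⟨C, mem_of_superset (hV.mem_nhds hpV) hVC, hC, hCU.trans hUs⟩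
  rcases p with _ | ⟨_ | ⟨y, v⟩⟩
  · obtain ⟨V, C, hV, hC, hVC, hCU, -, h, -⟩ := exists_isOpen_isClosed hab hU False True
      (by simp) (fun _ => hp) (V₀ := fun _ => ∅) (C₀ := fun _ => ∅) (by simp) (by simp) (by simp)
      (by simp) (by simp) (by simp)
    exact ⟨V, C, hV, hC, hVC, hCU, h trivial⟩
  · obtain ⟨V, C, hV, hC, hVC, hCU, h, -, -⟩ := exists_isOpen_isClosed hab hU True False
      (fun _ => hp) (by simp) (V₀ := fun _ => ∅) (C₀ := fun _ => ∅) (by simp) (by simp) (by simp)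
      (by simp) (by simp) (by simp)
    exact ⟨V, C, hV, hC, hVC, hCU, h trivial⟩
  · obtain ⟨K, hK, hKc, hKs⟩ := exists_mem_nhds_isClosed_subset
      (((isOpen_iff.1 hU v).inter (toFinite {a, b}).isClosed.isOpen_compl).mem_nhds
        (show y.1 ∈ _ from ⟨by simpa using hp, by simp [y.2.1, y.2.2]⟩))
    obtain ⟨V, C, hV, hC, hVC, hCU, -, -, h⟩ := exists_isOpen_isClosed hab hU False False
      (by simp) (by simp) (V₀ := fun w => {p | w = v ∧ p ∈ interior K})
      (C₀ := fun w => {p | w = v ∧ p ∈ K})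
      (fun w => by by_cases h : w = v <;> simp [h]) (fun w => by by_cases h : w = v <;> simp [h, hKc])
      (fun w p h => ⟨h.1, interior_subset h.2⟩)
      (by rintro _ p ⟨rfl, h⟩; exact (hKs h).1)
      (fun w h => (hKs h.2).2 (by simp)) (fun w h => (hKs h.2).2 (by simp))
    exact ⟨V, C, hV, hC, hVC, hCU, h v y ⟨rfl, mem_interior_iff_mem_nhds.2 hK⟩⟩

theorem t1Space [T1Space P] : T1Space (Thread P a b) := by
  refine ⟨fun t => isClosed_iff.2 fun w => ?_⟩
  refine Subsingleton.isClosed fun p hp q hq => ?_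
  exact strand_injective w (hp.trans hq.symm)

/-- If no continuous real function separates `a` and `b` in `P`, then every continuous real function
on `Thread P a b` is constant. -/
theorem exists_forall_eq (hab : a ≠ b) (h : ∀ f : P → ℝ, Continuous f → f a = f b)
    {f : Thread P a b → ℝ} (hf : Continuous f) (t : Thread P a b) : f t = f hub := by
  cases t with
  | hub => rfl
  | node w => simpa [strand_right hab] using h _ (hf.comp (continuous_strand w))

end Thread

/-- There is a nondegenerate regular `T₁` space of cardinality at most `ℵ₁` on which every continuous
real function is constant. -/
theorem exists_t3Space_forall_continuous_const :
    ∃ (G : Type u) (_ : TopologicalSpace G), T3Space G ∧ Nontrivial G ∧ #G ≤ ℵ₁ ∧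
      ∀ f : G → ℝ, Continuous f → ∀ x y, f x = f y := by
  let W : Type u := (ℵ₁ : Cardinal.{u}).out
  have hW : #W = ℵ₁ := mk_out _
  have : Uncountable W := by
    rw [← aleph0_lt_mk_iff, hW]
    exact aleph0_lt_aleph_one
  have hab : (Ladder.bot : Ladder W) ≠ Ladder.top := by simp
  have h1 := Thread.regularSpace hab
  have h2 := Thread.t1Space (a := (Ladder.bot : Ladder W)) (b := Ladder.top)
  have h3 := aleph0_lt_aleph_one.{u}.le
  refine ⟨Thread (Ladder W) .bot .top, inferInstance, {}, ⟨.hub, .node [], by simp⟩,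
    Thread.mk_le h3 (Ladder.mk_le h3 hW.le), fun f hf x y => ?_⟩
  have h (f : Ladder W → ℝ) (hf : Continuous f) := (Ladder.apply_top_eq_apply_bot hf).symm
  rw [Thread.exists_forall_eq hab h hf x, Thread.exists_forall_eq hab h hf y]

/-! ### Step functions in powers of `G`. -/

/-- A function on the subsets of `K` which only depends on the trace on a finite set. -/
def StepFn (K G : Type u) : Type u := Σ s : Finset K, (Set s → G)

namespace StepFn

variable {K G I : Type u}

/-- The values of a step function at a family of subsets of `K`. -/
def eval (j : I → Set K) (p : StepFn K G) (i : I) : G := p.2 (Subtype.val ⁻¹' j i)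

theorem mk_le [Infinite K] (hG : #G ≤ #K) : #(StepFn K G) ≤ #K := by
  have hK := aleph0_le_mk K
  have h (s : Finset K) : #(Set s → G) ≤ #K := by
    have : Finite (Set s) := inferInstance
    obtain ⟨n, hn⟩ := lt_aleph0.1 (lt_aleph0_of_finite (Set s))
    rw [← power_def, hn]
    exact (power_le_power_right hG).trans (power_nat_le hK)
  unfold StepFn
  rw [mk_sigma]
  refine (sum_le_sum _ (fun _ => #K) h).trans ?_
  rw [sum_const', mk_finset_of_infinite, mul_eq_self hK]

theorem exists_finset_separating [Nonempty K] {j : I → Set K} (hj : Function.Injective j)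
    (T : Finset I) :
    ∃ s : Finset K, ∀ i ∈ T, ∀ i' ∈ T, (∀ k ∈ s, k ∈ j i ↔ k ∈ j i') → i = i' := by
  classical
  have h (i i' : I) : ∃ k, i ≠ i' → ¬ (k ∈ j i ↔ k ∈ j i') := by
    by_contra! hne
    obtain ⟨k⟩ := ‹Nonempty K›
    exact (hne k).1 (hj (Set.ext fun k => (hne k).2))
  choose k hk using h
  refine ⟨Finset.image₂ k T T, fun i hi i' hi' h => ?_⟩
  by_contra hne
  exact hk i i' hne (h _ (Finset.mem_image₂_of_mem hi hi'))

variable [TopologicalSpace G]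

theorem _root_.exists_finset_forall_eqOn_mem {O : Set (I → G)} (hO : IsOpen O) {f : I → G}
    (hf : f ∈ O) : ∃ T : Finset I, ∀ g : I → G, (∀ i ∈ T, g i = f i) → g ∈ O := by
  obtain ⟨T, U, hU, hTU⟩ := isOpen_pi_iff.1 hO f hf
  exact ⟨T, fun g hg => hTU fun i hi => by rw [hg i hi]; exact (hU i hi).2⟩

/-- Every nonempty open set of the product contains the values of `#K` step functions. -/
theorem le_mk_preimage_eval [Infinite K] [Nonempty G] {j : I → Set K} (hj : Function.Injective j)
    {O : Set (I → G)} (hO : IsOpen O) (hne : O.Nonempty) :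
    #K ≤ #(eval j ⁻¹' O : Set (StepFn K G)) := by
  classical
  obtain ⟨f, hf⟩ := hne
  obtain ⟨T, hT⟩ := exists_finset_forall_eqOn_mem hO hf
  obtain ⟨s, hs⟩ := exists_finset_separating hj T
  -- Adjoining any `k` to `s` keeps it separating, and distinct `k ∉ s` give distinct step
  -- functions.
  have h (k : K) : ∃ h : Set (insert k s : Finset K) → G, eval j ⟨insert k s, h⟩ ∈ O := by
    refine ⟨fun Z => if h : ∃ i ∈ T, Subtype.val ⁻¹' j i = Z then f h.choose
      else Classical.arbitrary G, hT _ fun i hi => ?_⟩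
    have hex : ∃ i' ∈ T, (Subtype.val ⁻¹' j i' : Set (insert k s : Finset K)) =
      Subtype.val ⁻¹' j i := ⟨i, hi, rfl⟩
    simp only [eval]
    rw [dif_pos hex]
    congr 1
    refine hs _ hex.choose_spec.1 _ hi fun l hl => ?_
    exact Set.ext_iff.1 hex.choose_spec.2 ⟨l, Finset.mem_insert_of_mem hl⟩
  choose h hh using h
  rw [← mk_compl_of_infinite (s : Set K) ((lt_aleph0_of_finite _).trans_le (aleph0_le_mk K))]
  refine mk_le_of_injective (f := fun k => ⟨⟨insert k.1 s, h k.1⟩, hh k.1⟩) fun k l hkl => ?_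
  have h1 : insert k.1 s = insert l.1 s := congrArg (fun p => p.1.1) hkl
  have h2 : k.1 ∈ insert l.1 s := h1 ▸ Finset.mem_insert_self _ _
  exact Subtype.ext ((Finset.mem_insert.1 h2).resolve_right k.2)

theorem continuous_eval (j : I → Set K) (s : Finset K) :
    Continuous fun h : Set s → G => eval j (⟨s, h⟩ : StepFn K G) :=
  continuous_pi fun i => continuous_apply (A := fun _ => G) (Subtype.val ⁻¹' j i : Set s)

end StepFn

/-- Change one coordinate at a time. -/
theorem eq_of_forall_continuous_const {ι : Type*} [Finite ι] {G : Type*} [TopologicalSpace G]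
    (hG : ∀ f : G → ℝ, Continuous f → ∀ x y, f x = f y) {f : (ι → G) → ℝ} (hf : Continuous f)
    (x y : ι → G) : f x = f y := by
  classical
  have := Fintype.ofFinite ι
  suffices h : ∀ s : Finset ι, f (s.piecewise x y) = f y by
    simpa using h Finset.univ
  intro s
  induction s using Finset.induction_on with
  | empty => simp
  | insert i s hi ih =>
    rw [Finset.piecewise_insert, ← ih]
    have h := hG (fun t => f (Function.update (s.piecewise x y) i t))
      (hf.comp (continuous_const.update i continuous_id)) (x i) (s.piecewise x y i)
    simpa using h

/-- A subspace of a power of `G` in which the step functions are dense inherits from `G` that every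
continuous real function is constant. -/
theorem StepFn.exists_forall_eq {K G I : Type u} [TopologicalSpace G] [Infinite K] [Nonempty G]
    (hG : ∀ f : G → ℝ, Continuous f → ∀ x y, f x = f y) {j : I → Set K}
    (hj : Function.Injective j) {X : Set (I → G)}
    (hX : range (eval j : StepFn K G → I → G) ⊆ X) {f : X → ℝ} (hf : Continuous f) :
    ∃ c, ∀ x, f x = c := by
  obtain ⟨g⟩ := ‹Nonempty G›
  -- The constant map `g` is a step function over every finite `s`, so all the images of finite
  -- powers of `G` share the point `c`.
  let c : X := ⟨eval j ⟨∅, fun _ => g⟩, hX (mem_range_self _)⟩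
  let φ : StepFn K G → X := fun p => ⟨eval j p, hX (mem_range_self p)⟩
  have hφ : DenseRange φ := by
    rw [DenseRange, dense_iff_inter_open]
    rintro U hU ⟨x, hx⟩
    obtain ⟨O, hO, rfl⟩ := isOpen_induced_iff.1 hU
    have h0 := (StepFn.le_mk_preimage_eval hj hO ⟨_, hx⟩)
    have : (eval j ⁻¹' O : Set (StepFn K G)).Nonempty := by
      rw [← nonempty_coe_sort, ← mk_ne_zero_iff]
      exact ((pos_iff_ne_zero.2 (mk_ne_zero K)).trans_le h0).ne'
    obtain ⟨p, hp⟩ := this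
    exact ⟨φ p, hp, mem_range_self p⟩
  refine ⟨f c, fun x => ?_⟩
  refine congrFun (hφ.equalizer hf continuous_const (funext ?_)) x
  rintro ⟨s, h⟩
  have hc : Continuous fun h : Set s → G => φ ⟨s, h⟩ := (continuous_eval j s).subtype_mk _
  exact eq_of_forall_continuous_const hG (hf.comp hc)
    h fun _ => g

/-! ### A dense set without two disjoint dense subsets. -/

section Irresolvable

variable {L I G : Type u} [TopologicalSpace G]

/-- `A` is large if it has `#L` many points in each nonempty open set of the product, with respect
to the map `x`. -/
def IsLarge (x : L → I → G) (A : Set L) : Prop :=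
  ∀ O : Set (I → G), IsOpen O → O.Nonempty → #L ≤ #(A ∩ x ⁻¹' O : Set L)

theorem IsLarge.mono {x : L → I → G} {A B : Set L} (hA : IsLarge x A) (h : A ⊆ B) : IsLarge x B :=
  fun O hO hne => (hA O hO hne).trans (mk_le_mk_of_subset (inter_subset_inter_left _ h))

theorem IsLarge.inter_compl [Infinite L] {x : L → I → G} {A R : Set L} (hA : IsLarge x A)
    (hR : #R < #L) : IsLarge x (Rᶜ ∩ A) := by
  intro O hO hne
  by_contra! hlt
  have h := hA O hO hne
  have hsub : A ∩ x ⁻¹' O ⊆ (Rᶜ ∩ A ∩ x ⁻¹' O) ∪ R := fun l hl => by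
    by_cases hlR : l ∈ R
    · exact .inr hlR
    · exact .inl ⟨⟨hlR, hl.1⟩, hl.2⟩
  exact (h.trans ((mk_le_mk_of_subset hsub).trans (mk_union_le _ _))).not_gt
    (add_lt_of_lt (aleph0_le_mk L) hlt hR)

/-- A maximal family of sets all of whose finite intersections are large. -/
theorem exists_maximal_isLarge {x : L → I → G} (hx : IsLarge x univ) :
    ∃ S : Set (Set L), (∀ t ⊆ S, t.Finite → IsLarge x (⋂₀ t)) ∧
      ∀ E ∉ S, ∃ t ⊆ S, t.Finite ∧ ¬ IsLarge x (E ∩ ⋂₀ t) := by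
  have hF : Order.IsOfFiniteCharacter {S : Set (Set L) | ∀ t ⊆ S, t.Finite → IsLarge x (⋂₀ t)} := by
    intro S
    refine ⟨fun h t ht _ t' ht' hfin => h t' (ht'.trans ht) hfin, fun h t ht hfin => ?_⟩
    exact h t ht hfin t Subset.rfl hfin
  obtain ⟨S, -, hS⟩ := hF.exists_maximal (x := ∅) (fun t ht _ => by
    rwa [subset_empty_iff.1 ht, sInter_empty])
  refine ⟨S, hS.prop, fun E hE => ?_⟩
  by_contra! hne
  refine hE (hS.le_of_ge (y := insert E S) (fun t ht hfin => ?_) (subset_insert E S)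
    (mem_insert E S))
  refine (hne (t \ {E}) ?_ (hfin.subset sdiff_subset)).mono ?_
  · rintro B ⟨hB, hBE⟩
    exact (ht hB).resolve_left hBE
  · rintro l ⟨hl, hl'⟩ B hB
    by_cases h : B = E
    · exact h ▸ hl
    · exact hl' B ⟨hB, h⟩

variable [T1Space G] [∀ g : G, (𝓝[≠] g).NeBot]

/-- Without isolated points in `G`, the complement of `{c, d}` is dense. Such boxes avoid the two
values that the later modification writes in. -/
theorem exists_box_subset (c d : G) {O : Set (I → G)} (hO : IsOpen O) (hne : O.Nonempty) :
    ∃ (T : Finset I) (U : I → Set G), (∀ i, IsOpen (U i)) ∧ (∀ i, (U i).Nonempty) ∧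
      (∀ i, U i ⊆ {c, d}ᶜ) ∧ (T : Set I).pi U ⊆ O := by
  classical
  obtain ⟨f, hf⟩ := hne
  obtain ⟨T, V, hV, hTV⟩ := isOpen_pi_iff.1 hO f hf
  have hdense : Dense ({c, d}ᶜ : Set G) := by
    rw [compl_eq_univ_sdiff]
    exact dense_univ.sdiff_finite (toFinite _)
  refine ⟨T, fun i => (if i ∈ T then V i else univ) ∩ {c, d}ᶜ, fun i => ?_, fun i => ?_,
    fun i => inter_subset_right, fun g hg => hTV fun i hi => ?_⟩
  · refine IsOpen.inter ?_ (toFinite {c, d}).isClosed.isOpen_compl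
    split_ifs with h
    exacts [(hV i h).1, isOpen_univ]
  · refine hdense.inter_open_nonempty _ ?_ ?_
    · split_ifs with h
      exacts [(hV i h).1, isOpen_univ]
    · split_ifs with h
      exacts [⟨_, (hV i h).2⟩, ⟨c, trivial⟩]
  · have := (hg i hi).1
    rwa [if_pos (show i ∈ T from hi)] at this

/-- An independent family of `2 ^ #L` maps from `L` to `G` can be modified in such a way that any
two disjoint subsets of `L` are not both dense. -/
theorem exists_injective_forall_dense_image [Infinite L] [Nontrivial G] (e : I ≃ Set L)
    {x : L → I → G} (hx : IsLarge x univ) :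
    ∃ y : L → I → G, Function.Injective y ∧ IsLarge y univ ∧
      ∀ E E' : Set L, Dense (y '' E) → Dense (y '' E') → (E ∩ E').Nonempty := by
  classical
  obtain ⟨S, hS, hSmax⟩ := exists_maximal_isLarge hx
  obtain ⟨c, d, hcd⟩ := exists_pair_ne G
  -- The value `c` is reserved to mark `l ∉ e i` for `e i ∈ S`; an original `c` becomes `d`. Each `B
  -- ∈ S` thus becomes relatively open, as the set where coordinate `e.symm B` differs from `c`.
  let y : L → I → G := fun l i =>
    if e i ∈ S → l ∈ e i then if x l i = c then d else x l i else c
  have hyc (B : Set L) (hB : B ∈ S) (l : L) : y l (e.symm B) ≠ c ↔ l ∈ B := by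
    by_cases hl : l ∈ B
    · simp only [y, Equiv.apply_symm_apply, hl, implies_true, if_true, iff_true]
      split_ifs with h
      exacts [hcd.symm, h]
    · simp [y, hl, hB]
  -- On boxes avoiding `c` and `d`, passing from `x` to `y` only adds membership in finitely many
  -- sets of `S`, which preserves largeness.
  have hbox (T : Finset I) (U : I → Set G) (hU : ∀ i, U i ⊆ {c, d}ᶜ) (l : L) :
      y l ∈ (T : Set I).pi U ↔ x l ∈ (T : Set I).pi U ∧ ∀ i ∈ T, e i ∈ S → l ∈ e i := by
    simp only [Set.mem_pi, SetLike.mem_coe]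
    rw [← forall₂_and]
    refine forall₂_congr fun i _ => ?_
    have hc : c ∉ U i := fun h => hU i h (by simp)
    have hd : d ∉ U i := fun h => hU i h (by simp)
    by_cases h : e i ∈ S → l ∈ e i
    · by_cases h' : x l i = c
      · simp only [y, if_pos h, if_pos h']; simp [h', hc, hd]
      · simp only [y, if_pos h, if_neg h']; exact ⟨fun h1 => ⟨h1, h⟩, fun h1 => h1.1⟩
    · simp only [y, if_neg h]; exact ⟨fun h1 => absurd h1 hc, fun h1 => absurd h1.2 h⟩
  have hcosmall (R : Set L) (hR : #R < #L) : Rᶜ ∈ S := by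
    by_contra h
    obtain ⟨t, ht, hfin, hlarge⟩ := hSmax _ h
    exact hlarge ((hS t ht hfin).inter_compl hR)
  have hopen (B : Set L) : IsOpen {g : I → G | g (e.symm B) ≠ c} :=
    isOpen_compl_singleton.preimage (continuous_apply _)
  -- If `E ∉ S`, maximality makes some trace `R` of `E` small, so `Rᶜ ∈ S`. Density of `E` then
  -- yields a point of both `R` and `Rᶜ`.
  have hmem (E : Set L) (hE : Dense (y '' E)) : E ∈ S := by
    by_contra h
    obtain ⟨t, ht, hfin, hlarge⟩ := hSmax _ h
    simp only [IsLarge, not_forall, not_le] at hlarge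
    obtain ⟨O, hO, hne, hlt⟩ := hlarge
    have hRS := hcosmall _ hlt
    obtain ⟨T, U, hUo, hUne, hUcd, hTU⟩ := exists_box_subset c d hO hne
    set R := E ∩ ⋂₀ t ∩ x ⁻¹' O with hR
    let O' : Set (I → G) := (T : Set I).pi U ∩
      ⋂ B ∈ insert Rᶜ t, {g : I → G | g (e.symm B) ≠ c}
    have hO' : IsOpen O' := (isOpen_set_pi T.finite_toSet fun i _ => hUo i).inter
      ((hfin.insert _).isOpen_biInter fun B _ => hopen B)
    choose g hg using hUne
    have hgc (i : I) : g i ≠ c := fun h => hUcd i (hg i) (by simp [h])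
    obtain ⟨_, ⟨hlT, hlB⟩, l, hlE, rfl⟩ := hE.inter_open_nonempty O' hO'
      ⟨g, fun i _ => hg i, mem_iInter₂.2 fun B _ => hgc _⟩
    have hlB' (B) (hB : B ∈ insert Rᶜ t) : l ∈ B :=
      (hyc B (hB.elim (fun h => h ▸ hRS) fun h => ht h) l).1 (mem_iInter₂.1 hlB B hB)
    exact hlB' _ (mem_insert _ _) ⟨⟨hlE, fun B hB => hlB' B (mem_insert_of_mem _ hB)⟩,
      hTU ((hbox T U hUcd l).1 hlT).1⟩
  refine ⟨y, fun l l' h => ?_, fun O hO hne => ?_, fun E E' hE hE' => ?_⟩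
  · by_contra hne
    have hlS := hcosmall {l} (by
      rw [mk_singleton]; exact one_lt_aleph0.trans_le (aleph0_le_mk L))
    have h1 := (hyc _ hlS l').2 (fun h => hne h.symm)
    rw [← h] at h1
    exact (hyc _ hlS l).1 h1 rfl
  · obtain ⟨T, U, hUo, hUne, hUcd, hTU⟩ := exists_box_subset c d hO hne
    choose g hg using hUne
    have ht : (e '' T ∩ S).Finite := (T.finite_toSet.image e).subset inter_subset_left
    refine (hS _ inter_subset_right ht _ (isOpen_set_pi T.finite_toSet fun i _ => hUo i)
      ⟨g, fun i _ => hg i⟩).trans (mk_le_mk_of_subset ?_)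
    rintro l ⟨hlt, hlU⟩
    refine ⟨trivial, hTU ((hbox T U hUcd l).2 ⟨hlU, fun i hi hiS => ?_⟩)⟩
    exact hlt _ ⟨mem_image_of_mem e hi, hiS⟩
  · obtain ⟨_, hl, l, hlE', rfl⟩ := hE'.inter_open_nonempty _ (hopen E) ⟨fun _ => d, hcd.symm⟩
    exact ⟨l, (hyc E (hmem E hE) l).1 hl, hlE'⟩

end Irresolvable

/-! ### Dispersion character, counting disjoint sets, and assembly of the space. -/

theorem dispersionCharacter_eq {X : Type u} [TopologicalSpace X] [Nonempty X]
    (h : ∀ U : Set X, IsOpen U → U.Nonempty → #X ≤ #U) : dispersionCharacter X = #X := by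
  have hmem : #X ∈ {c : Cardinal.{u} | ∃ U : Set X, IsOpen U ∧ U.Nonempty ∧ #U = c} :=
    ⟨univ, isOpen_univ, univ_nonempty, mk_univ⟩
  refine le_antisymm (csInf_le' hmem) (le_csInf ⟨_, hmem⟩ ?_)
  rintro c ⟨U, hU, hne, rfl⟩
  exact h U hU hne

/-- Among more than `κ` pairwise disjoint sets, two miss a given set of cardinality `κ`. -/
theorem exists_ne_disjoint_of_mk_le {X : Type u} {κ : Cardinal.{u}} (hκ : ℵ₀ ≤ κ)
    {𝒟 : Set (Set X)} (h𝒟 : κ < #𝒟) (hdisj : 𝒟.PairwiseDisjoint id) {R : Set X} (hR : #R ≤ κ) :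
    ∃ D ∈ 𝒟, ∃ D' ∈ 𝒟, D ≠ D' ∧ Disjoint D R ∧ Disjoint D' R := by
  by_contra! hne
  have h1 : #{D ∈ 𝒟 | ¬ Disjoint D R} ≤ κ := by
    refine le_trans ?_ hR
    have hex (D : {D ∈ 𝒟 | ¬ Disjoint D R}) : ∃ p : R, p.1 ∈ D.1 := by
      obtain ⟨p, hpD, hpR⟩ := not_disjoint_iff.1 D.2.2
      exact ⟨⟨p, hpR⟩, hpD⟩
    choose p hp using hex
    refine mk_le_of_injective (f := p) fun D D' h => Subtype.ext ?_
    exact hdisj.elim_set D.2.1 D'.2.1 _ (hp D) (h ▸ hp D')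
  have h2 : #{D ∈ 𝒟 | Disjoint D R} ≤ 1 := mk_le_one_iff_set_subsingleton.2 fun D hD D' hD' => by
    by_contra h
    exact hne D hD.1 D' hD'.1 h hD.2 hD'.2
  have hsub : 𝒟 ⊆ {D ∈ 𝒟 | ¬ Disjoint D R} ∪ {D ∈ 𝒟 | Disjoint D R} := fun D hD => by
    by_cases h : Disjoint D R
    · exact .inr ⟨hD, h⟩
    · exact .inl ⟨hD, h⟩
  exact h𝒟.not_ge ((mk_le_mk_of_subset hsub).trans ((mk_union_le _ _).trans
    (add_le_of_le hκ h1 (h2.trans (one_le_aleph0.trans hκ)))))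

theorem connectedSpace_of_forall_continuous_const {X : Type*} [TopologicalSpace X] [Nonempty X]
    (h : ∀ f : X → ℝ, Continuous f → ∀ x y, f x = f y) : ConnectedSpace X := by
  have : PreconnectedSpace X := preconnectedSpace_of_forall_constant fun f hf x y => by
    have := h (fun t => if f t then 1 else 0)
      ((continuous_of_discreteTopology (f := fun b : Bool => if b then (1 : ℝ) else 0)).comp hf) x y
    by_cases hx : f x <;> by_cases hy : f y <;> simp_all
  exact ConnectedSpace.mk ‹_›

theorem theorem5p5 (κ lam : Cardinal.{u}) (hκ : ℵ₁ ≤ κ) (hlt : κ < lam)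
    (hpow : (2 : Cardinal.{u}) ^ κ = (2 : Cardinal.{u}) ^ lam) :
    ∃ (X : Type u) (_ : TopologicalSpace X),
      T3Space X ∧
      #X = lam ∧
      dispersionCharacter X = lam ∧
      (∀ f : X → ℝ, Continuous f → ∃ c : ℝ, ∀ x : X, f x = c) ∧
      ConnectedSpace X ∧
      IsPseudocompact X ∧
      IsIrresolvable (Order.succ κ) X := by
  obtain ⟨G, _, _, _, hGκ, hG⟩ := exists_t3Space_forall_continuous_const.{u}
  -- A nontrivial connected T₁ space has no isolated points, as
  -- `exists_injective_forall_dense_image` requires of `G`.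
  have := connectedSpace_of_forall_continuous_const hG
  have hκ0 : ℵ₀ ≤ κ := aleph0_lt_aleph_one.le.trans hκ
  obtain ⟨K, rfl⟩ : ∃ K : Type u, #K = κ := ⟨_, mk_out κ⟩
  obtain ⟨Λ, rfl⟩ : ∃ Λ : Type u, #Λ = lam := ⟨_, mk_out lam⟩
  have : Infinite K := infinite_iff.2 hκ0
  have : Infinite Λ := infinite_iff.2 (hκ0.trans hlt.le)
  have hGK : #G ≤ #K := hGκ.trans hκ
  have hlarge : IsLarge (StepFn.eval id : StepFn Λ G → Set Λ → G) univ := fun O hO hne => by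
    rw [univ_inter]
    exact (StepFn.mk_le (hGK.trans hlt.le)).trans
      (StepFn.le_mk_preimage_eval Function.injective_id hO hne)
  have hL : #(StepFn Λ G) = #Λ := by
    refine (StepFn.mk_le (hGK.trans hlt.le)).antisymm ?_
    exact (StepFn.le_mk_preimage_eval (I := Set Λ) Function.injective_id isOpen_univ
      univ_nonempty).trans (mk_set_le _)
  have : Infinite (StepFn Λ G) := infinite_iff.2 (hL ▸ aleph0_le_mk Λ)
  obtain ⟨e⟩ : Nonempty (Set Λ ≃ Set (StepFn Λ G)) := by
    rw [← Cardinal.eq, mk_set, mk_set, hL]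
  -- Here `2 ^ κ = 2 ^ λ` enters: step functions over the smaller set `K` become dense in the power
  -- with exponent `Set Λ`.
  obtain ⟨j⟩ : Nonempty (Set Λ ≃ Set K) := by
    rw [← Cardinal.eq, mk_set, mk_set, hpow]
  obtain ⟨y, hy, hylarge, hyE⟩ := exists_injective_forall_dense_image e hlarge
  set F : Set (Set Λ → G) := range (StepFn.eval j : StepFn K G → Set Λ → G) with hF
  have hFK : #F ≤ #K := mk_range_le.trans (StepFn.mk_le hGK)
  have hY : #(range y) = #Λ := (mk_range_eq y hy).trans hL
  set X : Set (Set Λ → G) := F ∪ range y with hX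
  have hXopen (O : Set (Set Λ → G)) (hO : IsOpen O) (hne : O.Nonempty) :
      #Λ ≤ #(Subtype.val ⁻¹' O : Set X) := by
    have h := hylarge O hO hne
    rw [univ_inter, hL] at h
    refine h.trans (mk_le_of_injective (f := fun l => ⟨⟨y l.1, .inr (mem_range_self _)⟩, l.2⟩) ?_)
    intro l l' h
    exact Subtype.ext (hy (congrArg (fun p => p.1.1) h))
  have hXcard : #X = #Λ := by
    refine le_antisymm ((mk_union_le _ _).trans ?_) (hY ▸ mk_le_mk_of_subset subset_union_right)
    exact add_le_of_le (aleph0_le_mk Λ) (hFK.trans hlt.le) hY.le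
  have : Nonempty X := mk_ne_zero_iff.1 (hXcard ▸ mk_ne_zero Λ)
  have hΔ : dispersionCharacter X = #Λ := by
    rw [← hXcard]
    refine dispersionCharacter_eq fun U hU hne => ?_
    obtain ⟨O, hO, rfl⟩ := isOpen_induced_iff.1 hU
    obtain ⟨x, hx⟩ := hne
    exact hXcard.trans_le (hXopen O hO ⟨_, hx⟩)
  have hXdense : DenseRange (Subtype.val : X → Set Λ → G) := by
    rw [DenseRange, dense_iff_inter_open]
    intro O hO hne
    have h := mk_ne_zero_iff.1 ((pos_iff_ne_zero.2 (mk_ne_zero Λ)).trans_le (hXopen O hO hne)).ne'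
    obtain ⟨x, hx⟩ := h
    exact ⟨x, hx, mem_range_self x⟩
  have hconst : ∀ f : X → ℝ, Continuous f → ∃ c, ∀ x, f x = c := fun f hf =>
    StepFn.exists_forall_eq hG j.injective subset_union_left hf
  refine ⟨X, inferInstance, inferInstance, hXcard, hΔ, hconst,
    connectedSpace_of_forall_continuous_const fun f hf x x' => ?_,
    fun f hf => ?_, hΔ ▸ Order.succ_le_of_lt hlt, ?_⟩
  · obtain ⟨c, hc⟩ := hconst f hf
    rw [hc, hc]
  · obtain ⟨c, hc⟩ := hconst f hf
    exact Bornology.isBounded_singleton.subset (range_subset_iff.2 hc : range f ⊆ {c})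
  · rintro ⟨𝒟, h𝒟, hdense, hdisj⟩
    have hR : #(Subtype.val ⁻¹' F : Set X) ≤ #K :=
      (mk_preimage_of_injective _ _ Subtype.val_injective).trans hFK
    obtain ⟨D, hD, D', hD', hne, hDF, hDF'⟩ := exists_ne_disjoint_of_mk_le hκ0
      (h𝒟 ▸ Order.lt_succ _) hdisj hR
    have himage (D : Set X) (hDF : Disjoint D (Subtype.val ⁻¹' F)) (hD : Dense D) :
        Dense (y '' (y ⁻¹' (Subtype.val '' D))) := by
      rw [image_preimage_eq_of_subset]
      · exact hXdense.dense_image continuous_subtype_val hD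
      · rintro _ ⟨x, hx, rfl⟩
        exact x.2.resolve_left fun h => disjoint_left.1 hDF hx h
    obtain ⟨l, ⟨x, hx, hxl⟩, x', hx', hxl'⟩ := hyE _ _ (himage D hDF (hdense D hD))
      (himage D' hDF' (hdense D' hD'))
    obtain rfl : x = x' := Subtype.ext (hxl.trans hxl'.symm)
    exact disjoint_left.1 (hdisj hD hD' hne) hx hx'
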